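/- Consider the call-by-value $\lambda$-calculus with shift and reset, with terms (up to $\alpha$-conversion) $t ::= x \mid \lambda x.t \mid t\,t \mid \mathcal{S}k.t \mid \langle t\rangle$, values $v ::= \lambda x.t$, pure contexts $E ::= \square \mid v\,E \mid E\,t$, evaluation contexts $F ::= \square \mid v\,F \mid F\,t \mid \langle F\rangle$, and reduction $F[(\lambda x.t)\,v] \to F[t\{v/x\}]$, $F[\langle E[\mathcal{S}k.t]\rangle] \to F[\langle t\{\lambda x.\langle E[x]\rangle/k\}\rangle]$ ($x$ not free in $E$), $F[\langle v\rangle] \to F[v]$. A term is stuck if it is irreducible and not a value; $\to^*$ is the reflexive transitive closure of $\to$; programs are the terms $\langle t\rangle$. An environment $\Gamma$ is a relation on closed terms that relates values with values and, in the relaxed case only, possibly also stuck terms with stuck terms. $\widehat\Gamma$ denotes the closure of $\Gamma$ under all term constructors (including variables), restricted to closed terms; two closed pure contexts are related by the context closure of $\Gamma$ if they are built in parallel from $\square$, $v\,E$ and $E\,t$ with values and terms related by $\widehat\Gamma$. An environmental relation $\mathcal{X}$ is a set of environments $\Gamma$ and of triples $(\Gamma,t_0,t_1)$ with $t_0,t_1$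 closed; write $t_0\,\mathcal{X}_\Gamma\,t_1$ for $(\Gamma,t_0,t_1)\in\mathcal{X}$. (Original semantics; environments relate only values.) $\mathcal{X}$ is an environmental bisimulation for programs if: (1) if $t_0\,\mathcal{X}_\Gamma\,t_1$ and $t_0,t_1$ are not both programs, then $\langle E_0[t_0]\rangle\,\mathcal{X}_\Gamma\,\langle E_1[t_1]\rangle$ for all closed pure $E_0,E_1$ related by the context closure of $\Gamma$; (2) if $p_0\,\mathcal{X}_\Gamma\,p_1$ with $p_0,p_1$ programs, then $p_0\to p_0'$ with $p_0'$ a program implies $p_1\to^* p_1'$ and $p_0'\,\mathcal{X}_\Gamma\,p_1'$ for some program $p_1'$, $p_0\to v_0$ with $v_0$ a value implies $p_1\to^* v_1$ and $\Gamma\cup\{(v_0,v_1)\}\in\mathcal{X}$ for some value $v_1$, and conversely with the roles of $p_0$ and $p_1$ exchanged; (3) if $\Gamma\in\mathcal{X}$, $\lambda x.t_0\,\Gamma\,\lambda x.t_1$ and $v_0\,\widehat\Gamma\,v_1$ with $v_0,v_1$ values, then $t_0\{v_0/x\}\,\mathcal{X}_\Gamma\,t_1\{v_1/x\}$. Program bisimilarity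 $\simeq_p$ is the relation on closed terms induced, at $\Gamma=\emptyset$, by the largest such $\mathcal{X}$; on open terms its open extension $\simeq_p^\circ$ relates $t_0$ and $t_1$ if $\lambda\vec{x}.t_0\simeq_p\lambda\vec{x}.t_1$, where $\vec{x}$ lists the variables of any finite scope containing the free variables of $t_0$ and $t_1$ (so the closed case is $\simeq_p$, with $\vec x$ empty). (Relaxed semantics; environments relate values with values and stuck terms with stuck terms.) $\mathcal{X}$ is an environmental bisimulation if: (1) $t_0\,\mathcal{X}_\Gamma\,t_1$ implies: if $t_0\to t_0'$ then $t_1\to^* t_1'$ with $t_0'\,\mathcal{X}_\Gamma\,t_1'$ for some $t_1'$; if $t_0$ is a value (resp. stuck) then $t_1\to^* t_1'$ with $t_1'$ a value (resp. stuck) and $\Gamma\cup\{(t_0,t_1')\}\in\mathcal{X}$ for some $t_1'$; and conversely with the roles of $t_0$ and $t_1$ exchanged; (2) $\Gamma\in\mathcal{X}$ implies clause (3) above and, if $E_0[\mathcal{S}k.t_0]\,\Gamma\,E_1[\mathcal{S}k.t_1]$ and $E_0',E_1'$ are related by the context closure of $\Gamma$, then $\langle t_0\{\lambda x.\langle E_0'[E_0[x]]\rangle/k\}\rangle\,\mathcal{X}_\Gamma\,\langle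 t_1\{\lambda x.\langle E_1'[E_1[x]]\rangle/k\}\rangle$ for a fresh $x$. Relaxed bisimilarity $\simeq$ is the relation on closed terms induced, at $\Gamma=\emptyset$, by the largest such $\mathcal{X}$. **Lemma.** Let $x\neq k$ be variables and let $t_0,t_1$ be terms with $k\notin\mathrm{fv}(t_1)$. Then $$(\lambda x.\,\mathcal{S}k.\,t_0)\;t_1 \;\simeq_p^\circ\; \mathcal{S}k.\,\big((\lambda x.\,t_0)\;t_1\big);$$ in particular the two terms are related by $\simeq_p$ when they are closed. The equivalence does not hold in general for $\simeq$: there are $t_0,t_1$ for which the two terms are closed but not related by $\simeq$. More precisely, they are not related by $\simeq$ whenever they are closed and $t_1$ diverges (has an infinite reduction sequence). -/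

import Mathlib

namespace ShiftReset

/-! ## Terms -/

/-- Terms of the call-by-value lambda-calculus with `shift` and `reset`, up to alpha-conversion:
well-scoped de Bruijn terms.  `Tm n` is the type of terms whose free variables are among `n`
variables; index `0` is the innermost variable.  `Tm 0` is the type of closed terms. -/
inductive Tm : ℕ → Type
  | var {n : ℕ} (i : Fin n) : Tm n
  | lam {n : ℕ} (t : Tm (n + 1)) : Tm n
  | app {n : ℕ} (s t : Tm n) : Tm n
  | shift {n : ℕ} (t : Tm (n + 1)) : Tm n
  | reset {n : ℕ} (t : Tm n) : Tm n

namespace Tm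

/-- Extension of a renaming under one binder. -/
def liftRen {n m : ℕ} (ρ : Fin n → Fin m) : Fin (n + 1) → Fin (m + 1) :=
  Fin.cases 0 (fun i => (ρ i).succ)

/-- Renaming of variables. -/
def rename {n : ℕ} (t : Tm n) {m : ℕ} (ρ : Fin n → Fin m) : Tm m :=
  match t with
  | var i => var (ρ i)
  | lam t => lam (t.rename (liftRen ρ))
  | app s t => app (s.rename ρ) (t.rename ρ)
  | shift t => shift (t.rename (liftRen ρ))
  | reset t => reset (t.rename ρ)

/-- `t` seen in a scope with one more variable (index `0`), which does not occur in the result.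
The terms over `n + 1` variables in which the variable `0` is not free are exactly these. -/
def weaken {n : ℕ} (t : Tm n) : Tm (n + 1) := t.rename Fin.succ

/-- A closed term seen in an arbitrary scope. -/
def ofClosed (t : Tm 0) (n : ℕ) : Tm n := t.rename Fin.elim0

/-- Exchange of the two innermost variables. -/
def exchange {n : ℕ} (t : Tm (n + 2)) : Tm (n + 2) := t.rename (Equiv.swap 0 1)

/-- Extension of a substitution under one binder. -/
def liftSub {n m : ℕ} (σ : Fin n → Tm m) : Fin (n + 1) → Tm (m + 1) :=
  Fin.cases (var 0) (fun i => (σ i).weaken)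

/-- Simultaneous capture-avoiding substitution. -/
def subst {n : ℕ} (t : Tm n) {m : ℕ} (σ : Fin n → Tm m) : Tm m :=
  match t with
  | var i => σ i
  | lam t => lam (t.subst (liftSub σ))
  | app s t => app (s.subst σ) (t.subst σ)
  | shift t => shift (t.subst (liftSub σ))
  | reset t => reset (t.subst σ)

/-- Substitution of `v` for the innermost variable. -/
def inst {n : ℕ} (t : Tm (n + 1)) (v : Tm n) : Tm n := t.subst (Fin.cases v var)

/-- Values are the lambda-abstractions. -/
def IsValue {n : ℕ} (t : Tm n) : Prop := ∃ b : Tm (n + 1), t = lam b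

/-- Programs are the terms of the form `reset t`. -/
def IsProgram {n : ℕ} (t : Tm n) : Prop := ∃ s : Tm n, t = reset s

/-- Abstraction over all the variables in scope. -/
def lams : {n : ℕ} → Tm n → Tm 0
  | 0, t => t
  | _ + 1, t => lams (lam t)

end Tm

/-! ## Contexts -/

/-- Pure contexts `E ::= [] | v E | E t`.  As a value is an abstraction, the frame `v E` is
given by the body of `v`. -/
inductive PCtx : ℕ → Type
  | hole {n : ℕ} : PCtx n
  | vapp {n : ℕ} (b : Tm (n + 1)) (E : PCtx n) : PCtx n
  | app {n : ℕ} (E : PCtx n) (t : Tm n) : PCtx n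

/-- Evaluation contexts `F ::= [] | v F | F t | reset F`. -/
inductive ECtx : ℕ → Type
  | hole {n : ℕ} : ECtx n
  | vapp {n : ℕ} (b : Tm (n + 1)) (F : ECtx n) : ECtx n
  | app {n : ℕ} (F : ECtx n) (t : Tm n) : ECtx n
  | reset {n : ℕ} (F : ECtx n) : ECtx n

/-- Filling of a pure context. -/
def PCtx.plug {n : ℕ} : PCtx n → Tm n → Tm n
  | .hole, s => s
  | .vapp b E, s => .app (.lam b) (E.plug s)
  | .app E t, s => .app (E.plug s) t

/-- Filling of an evaluation context. -/
def ECtx.plug {n : ℕ} : ECtx n → Tm n → Tm n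
  | .hole, s => s
  | .vapp b F, s => .app (.lam b) (F.plug s)
  | .app F t, s => .app (F.plug s) t
  | .reset F, s => .reset (F.plug s)

/-- A pure context seen in a scope with one more variable (index `0`), not occurring in it. -/
def PCtx.weaken {n : ℕ} : PCtx n → PCtx (n + 1)
  | .hole => .hole
  | .vapp b E => .vapp (b.rename (Tm.liftRen Fin.succ)) E.weaken
  | .app E t => .app E.weaken t.weaken

/-! ## Reduction -/

/-- Call-by-value reduction. -/
inductive Red {n : ℕ} : Tm n → Tm n → Prop
  | beta (F : ECtx n) (t b : Tm (n + 1)) :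
      Red (F.plug (.app (.lam t) (.lam b))) (F.plug (t.inst (.lam b)))
  | shift (F : ECtx n) (E : PCtx n) (t : Tm (n + 1)) :
      Red (F.plug (.reset (E.plug (.shift t))))
        (F.plug (.reset (t.inst (.lam (.reset (E.weaken.plug (.var 0)))))))
  | reset (F : ECtx n) (b : Tm (n + 1)) :
      Red (F.plug (.reset (.lam b))) (F.plug (.lam b))

/-- Reflexive and transitive closure of reduction. -/
def Reds {n : ℕ} : Tm n → Tm n → Prop := Relation.ReflTransGen Red

/-- A stuck term is an irreducible term which is not a value. -/
def IsStuck {n : ℕ} (t : Tm n) : Prop := ¬ t.IsValue ∧ ∀ t', ¬ Red t t'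

/-- `t` admits an infinite reduction sequence. -/
def Diverges {n : ℕ} (t : Tm n) : Prop :=
  ∃ f : ℕ → Tm n, f 0 = t ∧ ∀ i, Red (f i) (f (i + 1))

/-! ## Environments and context closures -/

/-- Relations on closed terms; the environments are those satisfying `IsNFEnv` (relaxed
semantics) or `IsValueEnv` (original semantics). -/
abbrev Env := Set (Tm 0 × Tm 0)

/-- Environments of the relaxed semantics relate values with values and stuck terms with stuck
terms. -/
def IsNFEnv (Γ : Env) : Prop :=
  ∀ s t, (s, t) ∈ Γ → (s.IsValue ∧ t.IsValue) ∨ (IsStuck s ∧ IsStuck t)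

/-- Environments of the original semantics relate values with values. -/
def IsValueEnv (Γ : Env) : Prop := ∀ s t, (s, t) ∈ Γ → s.IsValue ∧ t.IsValue

/-- The term generating closure of a relation on closed terms. -/
inductive TmClosure (Γ : Env) : {n : ℕ} → Tm n → Tm n → Prop
  | base {n : ℕ} {s t : Tm 0} {s' t' : Tm n} (h : (s, t) ∈ Γ) (hs : s' = s.ofClosed n)
      (ht : t' = t.ofClosed n) : TmClosure Γ s' t'
  | var {n : ℕ} (i : Fin n) : TmClosure Γ (.var i) (.var i)
  | lam {n : ℕ} {s t : Tm (n + 1)} : TmClosure Γ s t → TmClosure Γ (.lam s) (.lam t)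
  | app {n : ℕ} {s s' t t' : Tm n} :
      TmClosure Γ s s' → TmClosure Γ t t' → TmClosure Γ (.app s t) (.app s' t')
  | shift {n : ℕ} {s t : Tm (n + 1)} : TmClosure Γ s t → TmClosure Γ (.shift s) (.shift t)
  | reset {n : ℕ} {s t : Tm n} : TmClosure Γ s t → TmClosure Γ (.reset s) (.reset t)

/-- The context generating closure of a relation on closed terms, on closed pure contexts. -/
inductive PCtxClosure (Γ : Env) : PCtx 0 → PCtx 0 → Prop
  | hole : PCtxClosure Γ .hole .hole
  | vapp {b b' : Tm 1} {E E' : PCtx 0} : PCtxClosure Γ E E' →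
      TmClosure Γ (Tm.lam b) (Tm.lam b') → PCtxClosure Γ (.vapp b E) (.vapp b' E')
  | app {E E' : PCtx 0} {t t' : Tm 0} : PCtxClosure Γ E E' →
      TmClosure Γ t t' → PCtxClosure Γ (.app E t) (.app E' t')

/-- A set of environments and of triples (environment, closed term, closed term). -/
structure EnvRel where
  env : Env → Prop
  tm : Env → Tm 0 → Tm 0 → Prop

/-! ## Environmental bisimilarity for the relaxed semantics -/

/-- Environmental bisimulations (relaxed semantics). -/
structure IsBisim (R : EnvRel) : Prop where
  wf_env : ∀ Γ, R.env Γ → IsNFEnv Γ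
  wf_tm : ∀ Γ s t, R.tm Γ s t → IsNFEnv Γ
  red_left : ∀ Γ s t, R.tm Γ s t → ∀ s', Red s s' → ∃ t', Reds t t' ∧ R.tm Γ s' t'
  val_left : ∀ Γ s t, R.tm Γ s t → s.IsValue →
    ∃ t', Reds t t' ∧ t'.IsValue ∧ R.env (Γ ∪ {(s, t')})
  stuck_left : ∀ Γ s t, R.tm Γ s t → IsStuck s →
    ∃ t', Reds t t' ∧ IsStuck t' ∧ R.env (Γ ∪ {(s, t')})
  red_right : ∀ Γ s t, R.tm Γ s t → ∀ t', Red t t' → ∃ s', Reds s s' ∧ R.tm Γ s' t'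
  val_right : ∀ Γ s t, R.tm Γ s t → t.IsValue →
    ∃ s', Reds s s' ∧ s'.IsValue ∧ R.env (Γ ∪ {(s', t)})
  stuck_right : ∀ Γ s t, R.tm Γ s t → IsStuck t →
    ∃ s', Reds s s' ∧ IsStuck s' ∧ R.env (Γ ∪ {(s', t)})
  env_val : ∀ Γ, R.env Γ → ∀ (s t : Tm 1) (v w : Tm 0), (Tm.lam s, Tm.lam t) ∈ Γ →
    v.IsValue → w.IsValue → TmClosure Γ v w → R.tm Γ (s.inst v) (t.inst w)
  env_stuck : ∀ Γ, R.env Γ → ∀ (E₀ E₁ : PCtx 0) (s t : Tm 1) (E₀' E₁' : PCtx 0),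
    (E₀.plug (.shift s), E₁.plug (.shift t)) ∈ Γ → PCtxClosure Γ E₀' E₁' →
    R.tm Γ
      (.reset (s.inst (.lam (.reset (E₀'.weaken.plug (E₀.weaken.plug (.var 0)))))))
      (.reset (t.inst (.lam (.reset (E₁'.weaken.plug (E₁.weaken.plug (.var 0)))))))

/-- Environmental bisimilarity (relaxed semantics): the largest environmental bisimulation. -/
def bisimilarity : EnvRel where
  env Γ := ∃ R, IsBisim R ∧ R.env Γ
  tm Γ s t := ∃ R, IsBisim R ∧ R.tm Γ s t

/-- Bisimilarity of closed terms in the relaxed semantics: the empty environment. -/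
def Bisimilar (s t : Tm 0) : Prop := bisimilarity.tm ∅ s t

/-! ## Environmental bisimilarity for the original semantics -/

/-- Environmental bisimulations for programs (original semantics). -/
structure IsProgBisim (R : EnvRel) : Prop where
  wf_env : ∀ Γ, R.env Γ → IsValueEnv Γ
  wf_tm : ∀ Γ s t, R.tm Γ s t → IsValueEnv Γ
  term : ∀ Γ s t, R.tm Γ s t → ¬ (s.IsProgram ∧ t.IsProgram) →
    ∀ E₀ E₁, PCtxClosure Γ E₀ E₁ → R.tm Γ (.reset (E₀.plug s)) (.reset (E₁.plug t))
  red_left : ∀ Γ p q, R.tm Γ p q → p.IsProgram → q.IsProgram →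
    ∀ p', p'.IsProgram → Red p p' → ∃ q', q'.IsProgram ∧ Reds q q' ∧ R.tm Γ p' q'
  val_left : ∀ Γ p q, R.tm Γ p q → p.IsProgram → q.IsProgram →
    ∀ v, v.IsValue → Red p v → ∃ w, w.IsValue ∧ Reds q w ∧ R.env ({(v, w)} ∪ Γ)
  red_right : ∀ Γ p q, R.tm Γ p q → p.IsProgram → q.IsProgram →
    ∀ q', q'.IsProgram → Red q q' → ∃ p', p'.IsProgram ∧ Reds p p' ∧ R.tm Γ p' q'
  val_right : ∀ Γ p q, R.tm Γ p q → p.IsProgram → q.IsProgram →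
    ∀ w, w.IsValue → Red q w → ∃ v, v.IsValue ∧ Reds p v ∧ R.env ({(v, w)} ∪ Γ)
  env_val : ∀ Γ, R.env Γ → ∀ (s t : Tm 1) (v w : Tm 0), (Tm.lam s, Tm.lam t) ∈ Γ →
    v.IsValue → w.IsValue → TmClosure Γ v w → R.tm Γ (s.inst v) (t.inst w)

/-- Environmental bisimilarity for programs: the largest environmental bisimulation for
programs. -/
def progBisimilarity : EnvRel where
  env Γ := ∃ R, IsProgBisim R ∧ R.env Γ
  tm Γ s t := ∃ R, IsProgBisim R ∧ R.tm Γ s t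

/-- Program bisimilarity of closed terms: the empty environment. -/
def ProgBisimilar (s t : Tm 0) : Prop := progBisimilarity.tm ∅ s t

/-- Open extension of program bisimilarity: the variables in scope are abstracted.  On closed
terms (`n = 0`) this is `ProgBisimilar` itself. -/
def OpenProgBisimilar {n : ℕ} (s t : Tm n) : Prop := ProgBisimilar s.lams t.lams

/-! ## The two terms -/

/-- `(λx. shift k. t₀) t₁`.  In `t₀` the index `0` is `k` and the index `1` is `x`. -/
def stailLeft {n : ℕ} (t₀ : Tm (n + 2)) (t₁ : Tm n) : Tm n :=
  .app (.lam (.shift t₀)) t₁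

/-- `shift k. ((λx. t₀) t₁)`, for the same `t₀` (index `0` is `k`, index `1` is `x`) and for a
`t₁` in which `k` is not free: below `shift k. λx.` the two indices are exchanged, and `t₁` is
weakened by `k`. -/
def stailRight {n : ℕ} (t₀ : Tm (n + 2)) (t₁ : Tm n) : Tm n :=
  .shift (.app (.lam t₀.exchange) t₁.weaken)

end ShiftReset

-- Let both terms run in a delimited context `E`. The right one captures `E` at once and then
-- evaluates `t₁` in front of `λx. t₀`, with the reified `E` already substituted for `k`. The left
-- one evaluates `t₁` inside `E` and captures `E` afterwards. When `t₁` becomes a value, both reach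
-- the same term. Meanwhile `t₁` may itself capture its surroundings, so contexts that differ only
-- in whether `E` has already been captured must count as related. This leads to the congruence
-- `Rel` and its companion `RelCtx`, whose pairs are compared only under a reset.
--
-- The main lemma, `Rel.progress`, says that related closed programs both make at least one step
-- towards related terms. As reduction is deterministic, the relation `RedsRel` (reducing to related
-- terms) survives any step on either side, and it forms a bisimulation for programs. For open
-- terms, `Rel` is closed under abstraction.
--
-- In the relaxed semantics the right term is stuck immediately, whereas the left one diverges with
-- `t₁`; by determinism it never reaches a stuck term.

namespace ShiftReset

namespace Tm

/-! ## Substitution calculus -/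

@[simp] theorem rename_var {n m : ℕ} (ρ : Fin n → Fin m) (i : Fin n) :
    (var i).rename ρ = var (ρ i) := rfl
@[simp] theorem rename_lam {n m : ℕ} (ρ : Fin n → Fin m) (t : Tm (n + 1)) :
    (lam t).rename ρ = lam (t.rename (liftRen ρ)) := rfl
@[simp] theorem rename_app {n m : ℕ} (ρ : Fin n → Fin m) (s t : Tm n) :
    (app s t).rename ρ = app (s.rename ρ) (t.rename ρ) := rfl
@[simp] theorem rename_shift {n m : ℕ} (ρ : Fin n → Fin m) (t : Tm (n + 1)) :
    (shift t).rename ρ = shift (t.rename (liftRen ρ)) := rfl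
@[simp] theorem rename_reset {n m : ℕ} (ρ : Fin n → Fin m) (t : Tm n) :
    (reset t).rename ρ = reset (t.rename ρ) := rfl

@[simp] theorem subst_var {n m : ℕ} (σ : Fin n → Tm m) (i : Fin n) :
    (var i).subst σ = σ i := rfl
@[simp] theorem subst_lam {n m : ℕ} (σ : Fin n → Tm m) (t : Tm (n + 1)) :
    (lam t).subst σ = lam (t.subst (liftSub σ)) := rfl
@[simp] theorem subst_app {n m : ℕ} (σ : Fin n → Tm m) (s t : Tm n) :
    (app s t).subst σ = app (s.subst σ) (t.subst σ) := rfl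
@[simp] theorem subst_shift {n m : ℕ} (σ : Fin n → Tm m) (t : Tm (n + 1)) :
    (shift t).subst σ = shift (t.subst (liftSub σ)) := rfl
@[simp] theorem subst_reset {n m : ℕ} (σ : Fin n → Tm m) (t : Tm n) :
    (reset t).subst σ = reset (t.subst σ) := rfl

@[simp] theorem liftRen_zero {n m : ℕ} (ρ : Fin n → Fin m) : liftRen ρ 0 = 0 := rfl
@[simp] theorem liftRen_succ {n m : ℕ} (ρ : Fin n → Fin m) (i : Fin n) :
    liftRen ρ i.succ = (ρ i).succ := rfl
@[simp] theorem liftSub_zero {n m : ℕ} (σ : Fin n → Tm m) : liftSub σ 0 = var 0 := rfl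
@[simp] theorem liftSub_succ {n m : ℕ} (σ : Fin n → Tm m) (i : Fin n) :
    liftSub σ i.succ = (σ i).weaken := rfl

/-- The order of the fusion laws matters under binders: `rename_subst` needs `weaken_rename`, which
comes from `rename_rename`; `subst_subst` needs `weaken_subst`, which comes from the two mixed laws.
-/
theorem rename_rename {n : ℕ} (t : Tm n) {m k : ℕ} (ρ : Fin n → Fin m) (ξ : Fin m → Fin k) :
    (t.rename ρ).rename ξ = t.rename (fun i => ξ (ρ i)) := by
  have lift {n m k : ℕ} (ρ : Fin n → Fin m) (ξ : Fin m → Fin k) :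
      (fun i => liftRen ξ (liftRen ρ i)) = liftRen (fun i => ξ (ρ i)) := by
    funext i; refine Fin.cases ?_ (fun i => ?_) i <;> simp
  induction t generalizing m k with
  | var i => rfl
  | lam t ih => simp [ih, lift]
  | app s t ih₁ ih₂ => simp [ih₁, ih₂]
  | shift t ih => simp [ih, lift]
  | reset t ih => simp [ih]

theorem subst_rename {n : ℕ} (t : Tm n) {m k : ℕ} (ρ : Fin n → Fin m) (σ : Fin m → Tm k) :
    (t.rename ρ).subst σ = t.subst (fun i => σ (ρ i)) := by
  have lift {n m k : ℕ} (ρ : Fin n → Fin m) (σ : Fin m → Tm k) :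
      (fun i => liftSub σ (liftRen ρ i)) = liftSub (fun i => σ (ρ i)) := by
    funext i; refine Fin.cases ?_ (fun i => ?_) i <;> simp
  induction t generalizing m k with
  | var i => rfl
  | lam t ih => simp [ih, lift]
  | app s t ih₁ ih₂ => simp [ih₁, ih₂]
  | shift t ih => simp [ih, lift]
  | reset t ih => simp [ih]

theorem weaken_rename {n m : ℕ} (t : Tm n) (ρ : Fin n → Fin m) :
    t.weaken.rename (liftRen ρ) = (t.rename ρ).weaken := by
  simp [weaken, rename_rename]

theorem rename_subst {n : ℕ} (t : Tm n) {m k : ℕ} (σ : Fin n → Tm m) (ρ : Fin m → Fin k) :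
    (t.subst σ).rename ρ = t.subst (fun i => (σ i).rename ρ) := by
  have lift {n m k : ℕ} (σ : Fin n → Tm m) (ρ : Fin m → Fin k) :
      (fun i => (liftSub σ i).rename (liftRen ρ)) = liftSub (fun i => (σ i).rename ρ) := by
    funext i; refine Fin.cases ?_ (fun i => ?_) i <;> simp [weaken_rename]
  induction t generalizing m k with
  | var i => rfl
  | lam t ih => simp [ih, lift]
  | app s t ih₁ ih₂ => simp [ih₁, ih₂]
  | shift t ih => simp [ih, lift]
  | reset t ih => simp [ih]

theorem weaken_subst {n m : ℕ} (t : Tm n) (σ : Fin n → Tm m) :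
    t.weaken.subst (liftSub σ) = (t.subst σ).weaken := by
  simp [weaken, subst_rename, rename_subst]

theorem subst_subst {n : ℕ} (t : Tm n) {m k : ℕ} (σ : Fin n → Tm m) (τ : Fin m → Tm k) :
    (t.subst σ).subst τ = t.subst (fun i => (σ i).subst τ) := by
  have lift {n m k : ℕ} (σ : Fin n → Tm m) (τ : Fin m → Tm k) :
      (fun i => (liftSub σ i).subst (liftSub τ)) = liftSub (fun i => (σ i).subst τ) := by
    funext i; refine Fin.cases ?_ (fun i => ?_) i <;> simp [weaken_subst]
  induction t generalizing m k with
  | var i => rfl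
  | lam t ih => simp [ih, lift]
  | app s t ih₁ ih₂ => simp [ih₁, ih₂]
  | shift t ih => simp [ih, lift]
  | reset t ih => simp [ih]

theorem liftSub_var_comp {n m : ℕ} (ρ : Fin n → Fin m) :
    liftSub (fun i => var (ρ i)) = fun i => var (liftRen ρ i) := by
  funext i; refine Fin.cases ?_ (fun i => ?_) i <;> simp [weaken]

theorem rename_eq_subst {n : ℕ} (t : Tm n) {m : ℕ} (ρ : Fin n → Fin m) :
    t.rename ρ = t.subst (fun i => var (ρ i)) := by
  induction t generalizing m with
  | var i => rfl
  | lam t ih => simp [ih, liftSub_var_comp]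
  | app s t ih₁ ih₂ => simp [ih₁, ih₂]
  | shift t ih => simp [ih, liftSub_var_comp]
  | reset t ih => simp [ih]

theorem subst_id {n : ℕ} (t : Tm n) : t.subst var = t := by
  have lift {n : ℕ} : liftSub (var : Fin n → Tm n) = var := by
    funext i; refine Fin.cases ?_ (fun i => ?_) i <;> simp [weaken]
  induction t with
  | var i => rfl
  | lam t ih => simp [ih, lift]
  | app s t ih₁ ih₂ => simp [ih₁, ih₂]
  | shift t ih => simp [ih, lift]
  | reset t ih => simp [ih]

theorem weaken_inst {n : ℕ} (t v : Tm n) : t.weaken.inst v = t := by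
  simp [weaken, inst, subst_rename, subst_id]

theorem inst_subst {n m : ℕ} (t : Tm (n + 1)) (v : Tm n) (σ : Fin n → Tm m) :
    (t.inst v).subst σ = (t.subst (liftSub σ)).inst (v.subst σ) := by
  simp only [inst, subst_subst]
  congr 1
  funext i
  refine Fin.cases ?_ (fun i => ?_) i
  · simp
  · exact (weaken_inst (σ i) (v.subst σ)).symm

theorem exchange_subst {n m : ℕ} (t : Tm (n + 2)) (σ : Fin n → Tm m) :
    t.exchange.subst (liftSub (liftSub σ)) = (t.subst (liftSub (liftSub σ))).exchange := by
  simp only [exchange, subst_rename, rename_subst]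
  congr 1
  funext i
  refine Fin.cases ?_ (fun i => Fin.cases ?_ (fun i => ?_) i) i
  · simp only [Equiv.swap_apply_left]; rfl
  · have : Fin.succ (0 : Fin (n + 1)) = 1 := rfl
    rw [this, Equiv.swap_apply_right]; rfl
  · have h (k : ℕ) (j : Fin k) : Equiv.swap (0 : Fin (k + 2)) 1 j.succ.succ = j.succ.succ :=
      Equiv.swap_apply_of_ne_of_ne (Fin.succ_ne_zero _)
        (fun e => Fin.succ_ne_zero j (Fin.succ_injective _ e))
    rw [h]
    simp [weaken, rename_rename, h]

/-- Applied with `v` a reified context, this computes the body of the abstraction left after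
`stailRight` has captured its context. -/
theorem exchange_subst_inst {n : ℕ} (t : Tm (n + 2)) (v : Tm n) :
    t.exchange.subst (liftSub (Fin.cases v var)) = t.inst v.weaken := by
  simp only [exchange, subst_rename, inst]
  congr 1
  funext i
  refine Fin.cases ?_ (fun i => Fin.cases ?_ (fun i => ?_) i) i
  · simp only [Equiv.swap_apply_left]; rfl
  · have : Fin.succ (0 : Fin (n + 1)) = 1 := rfl
    rw [this, Equiv.swap_apply_right]; rfl
  · have h : Equiv.swap (0 : Fin (n + 2)) 1 i.succ.succ = i.succ.succ :=
      Equiv.swap_apply_of_ne_of_ne (Fin.succ_ne_zero _)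
        (fun e => Fin.succ_ne_zero i (Fin.succ_injective _ e))
    rw [h]
    rfl

end Tm

theorem stailLeft_subst {n m : ℕ} (t₀ : Tm (n + 2)) (t₁ : Tm n) (σ : Fin n → Tm m) :
    (stailLeft t₀ t₁).subst σ =
      stailLeft (t₀.subst (Tm.liftSub (Tm.liftSub σ))) (t₁.subst σ) := rfl

theorem stailRight_subst {n m : ℕ} (t₀ : Tm (n + 2)) (t₁ : Tm n) (σ : Fin n → Tm m) :
    (stailRight t₀ t₁).subst σ =
      stailRight (t₀.subst (Tm.liftSub (Tm.liftSub σ))) (t₁.subst σ) := by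
  simp [stailRight, Tm.exchange_subst, Tm.weaken_subst]

/-! ## Pure contexts -/

namespace PCtx

/-- Composition of pure contexts: `(E.comp G)[s] = E[G[s]]`. -/
def comp {n : ℕ} : PCtx n → PCtx n → PCtx n
  | .hole, G => G
  | .vapp b E, G => .vapp b (E.comp G)
  | .app E t, G => .app (E.comp G) t

/-- Simultaneous substitution in a pure context. -/
def subst {n m : ℕ} (σ : Fin n → Tm m) : PCtx n → PCtx m
  | .hole => .hole
  | .vapp b E => .vapp (b.subst (Tm.liftSub σ)) (E.subst σ)
  | .app E t => .app (E.subst σ) (t.subst σ)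

/-- The function reifying the delimited context `⟨E⟩`. -/
def reify {n : ℕ} (E : PCtx n) : Tm n := .lam (.reset (E.weaken.plug (.var 0)))

theorem plug_comp {n : ℕ} (E G : PCtx n) (s : Tm n) :
    (E.comp G).plug s = E.plug (G.plug s) := by
  induction E with
  | hole => rfl
  | vapp b E ih => simp [comp, plug, ih]
  | app E t ih => simp [comp, plug, ih]

theorem subst_comp {n m : ℕ} (σ : Fin n → Tm m) (E G : PCtx n) :
    (E.comp G).subst σ = (E.subst σ).comp (G.subst σ) := by
  induction E with
  | hole => rfl
  | vapp b E ih => simp [comp, subst, ih]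
  | app E t ih => simp [comp, subst, ih]

theorem plug_subst {n m : ℕ} (σ : Fin n → Tm m) (E : PCtx n) (s : Tm n) :
    (E.plug s).subst σ = (E.subst σ).plug (s.subst σ) := by
  induction E with
  | hole => rfl
  | vapp b E ih => simp [plug, subst, ih]
  | app E t ih => simp [plug, subst, ih]

theorem weaken_eq_subst {n : ℕ} (E : PCtx n) :
    E.weaken = E.subst (fun i => .var i.succ) := by
  induction E with
  | hole => rfl
  | vapp b E ih => simp [weaken, subst, ih, Tm.rename_eq_subst, Tm.liftSub_var_comp]
  | app E t ih => simp [weaken, subst, ih, Tm.weaken, Tm.rename_eq_subst]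

theorem weaken_subst {n m : ℕ} (σ : Fin n → Tm m) (E : PCtx n) :
    E.weaken.subst (Tm.liftSub σ) = (E.subst σ).weaken := by
  induction E with
  | hole => rfl
  | vapp b E ih =>
    have h : (fun i => Tm.liftSub (Tm.liftSub σ) (Tm.liftRen Fin.succ i)) =
        fun i => (Tm.liftSub σ i).rename (Tm.liftRen Fin.succ) := by
      funext i
      refine Fin.cases ?_ (fun i => ?_) i
      · simp
      · simp [Tm.weaken_rename]; rfl
    simp [weaken, subst, ih, Tm.subst_rename, Tm.rename_subst, h]
  | app E t ih => simp [weaken, subst, ih, Tm.weaken_subst]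

theorem reify_subst {n m : ℕ} (σ : Fin n → Tm m) (E : PCtx n) :
    E.reify.subst σ = (E.subst σ).reify := by
  simp [reify, plug_subst, weaken_subst]

end PCtx

/-! ## Reduction is deterministic -/

/-- The decomposition of a term as a capture `E[shift k. t]` in a pure context, if any. -/
def grab {n : ℕ} : Tm n → Option (PCtx n × Tm (n + 1))
  | .shift t => some (.hole, t)
  | .app (.lam b) t => (grab t).map fun p => (.vapp b p.1, p.2)
  | .app s t => (grab s).map fun p => (.app p.1 t, p.2)
  | _ => none

/-- One-step reduction as a partial function. -/
def step {n : ℕ} : Tm n → Option (Tm n)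
  | .app (.lam b) (.lam c) => some (b.inst (.lam c))
  | .app (.lam b) t => (step t).map (.app (.lam b))
  | .app s t => (step s).map fun s' => .app s' t
  | .reset (.lam b) => some (.lam b)
  | .reset s =>
    match grab s with
    | some (E, t) => some (.reset (t.inst E.reify))
    | none => (step s).map .reset
  | _ => none

theorem PCtx.plug_shift_ne_lam {n : ℕ} (E : PCtx n) (t b : Tm (n + 1)) :
    E.plug (.shift t) ≠ .lam b := by
  cases E <;> simp [PCtx.plug]

theorem grab_app {n : ℕ} {s : Tm n} (h : ∀ b, s ≠ .lam b) (t : Tm n) :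
    grab (.app s t) = (grab s).map fun p => (.app p.1 t, p.2) := by
  cases s <;> simp_all [grab]

theorem step_vapp {n : ℕ} (b : Tm (n + 1)) {t : Tm n} (h : ∀ b, t ≠ .lam b) :
    step (.app (.lam b) t) = (step t).map (.app (.lam b)) := by
  cases t <;> simp_all [step]

theorem step_app {n : ℕ} {s : Tm n} (h : ∀ b, s ≠ .lam b) (t : Tm n) :
    step (.app s t) = (step s).map fun s' => .app s' t := by
  cases s <;> simp_all [step]

theorem step_reset_grab {n : ℕ} {s : Tm n} {E : PCtx n} {t : Tm (n + 1)}
    (h : grab s = some (E, t)) : step (.reset s) = some (.reset (t.inst E.reify)) := by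
  cases s <;> simp_all [step, grab]

theorem step_reset {n : ℕ} {s : Tm n} (hs : ∀ b, s ≠ .lam b) (h : grab s = none) :
    step (.reset s) = (step s).map .reset := by
  cases s <;> simp_all [step, grab]

theorem grab_plug_shift {n : ℕ} (E : PCtx n) (t : Tm (n + 1)) :
    grab (E.plug (.shift t)) = some (E, t) := by
  induction E with
  | hole => simp [PCtx.plug, grab]
  | vapp b E ih => simp [PCtx.plug, grab, ih]
  | app E u ih =>
    simp [PCtx.plug, grab_app (PCtx.plug_shift_ne_lam E t), ih]

/-- The three facts go through the induction together: the application frames need a non-abstraction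
to select the right branch of `step`, and the reset frame needs in addition that no capture is
pending. -/
theorem step_plug {n : ℕ} (F : ECtx n) {r r' : Tm n} (hr : ∀ b, r ≠ .lam b)
    (hg : grab r = none) (hs : step r = some r') :
    (∀ b, F.plug r ≠ .lam b) ∧ grab (F.plug r) = none ∧
      step (F.plug r) = some (F.plug r') := by
  induction F with
  | hole => exact ⟨hr, hg, hs⟩
  | vapp b F ih =>
    obtain ⟨h₁, h₂, h₃⟩ := ih
    simp [ECtx.plug, grab, step_vapp b h₁, h₂, h₃]
  | app F t ih =>
    obtain ⟨h₁, h₂, h₃⟩ := ih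
    simp [ECtx.plug, grab_app h₁, step_app h₁, h₂, h₃]
  | reset F ih =>
    obtain ⟨h₁, h₂, h₃⟩ := ih
    simp [ECtx.plug, grab, step_reset h₁ h₂, h₃]

/-- Containment of `Red` in the graph of a function is all that determinism requires. -/
theorem Red.step_eq {n : ℕ} {s t : Tm n} (h : Red s t) : step s = some t := by
  cases h with
  | beta F t b => exact (step_plug F (by simp) (by simp [grab]) (by simp [step])).2.2
  | shift F E t =>
    exact (step_plug F (by simp) (by simp [grab]) (step_reset_grab (grab_plug_shift E t))).2.2
  | reset F b => exact (step_plug F (by simp) (by simp [grab]) (by simp [step])).2.2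

theorem Red.deterministic {n : ℕ} {s t u : Tm n} (h : Red s t) (h' : Red s u) : t = u :=
  Option.some.inj (h.step_eq.symm.trans h'.step_eq)

theorem not_red_lam {n : ℕ} (b : Tm (n + 1)) (t : Tm n) : ¬ Red (.lam b) t := fun h => by
  simpa [step] using h.step_eq

theorem isStuck_shift {n : ℕ} (t : Tm (n + 1)) : IsStuck (Tm.shift t) :=
  ⟨fun ⟨_, h⟩ => by simp at h, fun _ h => by simpa [step] using h.step_eq⟩

/-! ## Reduction in context -/

namespace ECtx

/-- Composition of evaluation contexts. -/
def comp {n : ℕ} : ECtx n → ECtx n → ECtx n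
  | .hole, G => G
  | .vapp b F, G => .vapp b (F.comp G)
  | .app F t, G => .app (F.comp G) t
  | .reset F, G => .reset (F.comp G)

theorem plug_comp {n : ℕ} (F G : ECtx n) (s : Tm n) :
    (F.comp G).plug s = F.plug (G.plug s) := by
  induction F with
  | hole => rfl
  | vapp b E ih => simp [comp, plug, ih]
  | app E t ih => simp [comp, plug, ih]
  | reset E ih => simp [comp, plug, ih]

end ECtx

/-- A pure context as an evaluation context. -/
def PCtx.toECtx {n : ℕ} : PCtx n → ECtx n
  | .hole => .hole
  | .vapp b E => .vapp b E.toECtx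
  | .app E t => .app E.toECtx t

theorem PCtx.plug_toECtx {n : ℕ} (E : PCtx n) (s : Tm n) : E.toECtx.plug s = E.plug s := by
  induction E with
  | hole => rfl
  | vapp b E ih => simp [toECtx, plug, ECtx.plug, ih]
  | app E t ih => simp [toECtx, plug, ECtx.plug, ih]

theorem Red.plug {n : ℕ} {s t : Tm n} (F : ECtx n) (h : Red s t) :
    Red (F.plug s) (F.plug t) := by
  cases h with
  | beta G t b => simpa [ECtx.plug_comp] using Red.beta (F.comp G) t b
  | shift G E t => simpa [ECtx.plug_comp] using Red.shift (F.comp G) E t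
  | reset G b => simpa [ECtx.plug_comp] using Red.reset (F.comp G) b

/-- Reduction under a delimited context. -/
theorem Red.reset_plug {n : ℕ} {s t : Tm n} (E : PCtx n) (h : Red s t) :
    Red (.reset (E.plug s)) (.reset (E.plug t)) := by
  simpa [ECtx.plug, PCtx.plug_toECtx] using h.plug (ECtx.reset E.toECtx)

theorem Red.beta_reset_plug {n : ℕ} (E : PCtx n) (t b : Tm (n + 1)) :
    Red (.reset (E.plug (.app (.lam t) (.lam b)))) (.reset (E.plug (t.inst (.lam b)))) :=
  (Red.beta .hole t b).reset_plug E

theorem Red.shift_reset_plug {n : ℕ} (E : PCtx n) (t : Tm (n + 1)) :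
    Red (.reset (E.plug (.shift t))) (.reset (t.inst E.reify)) :=
  Red.shift .hole E t

theorem Reds.reset_plug {n : ℕ} {s t : Tm n} (E : PCtx n) (h : Reds s t) :
    Reds (.reset (E.plug s)) (.reset (E.plug t)) := by
  induction h with
  | refl => exact .refl
  | tail _ h ih => exact ih.tail (h.reset_plug E)

theorem Red.transGen_reset_plug {n : ℕ} {s t : Tm n} (E : PCtx n)
    (h : Relation.TransGen Red s t) :
    Relation.TransGen Red (.reset (E.plug s)) (.reset (E.plug t)) := by
  induction h with
  | single h => exact .single (h.reset_plug E)
  | tail _ h ih => exact ih.tail (h.reset_plug E)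

/-- Capture by the term `stailRight`. -/
theorem Red.stailRight {n : ℕ} (E : PCtx n) (t₀ : Tm (n + 2)) (t₁ : Tm n) :
    Red (.reset (E.plug (stailRight t₀ t₁)))
      (.reset (.app (.lam (t₀.inst E.reify.weaken)) t₁)) := by
  have h := Red.shift_reset_plug E (.app (.lam t₀.exchange) t₁.weaken)
  have h' : Tm.inst (.app (.lam t₀.exchange) t₁.weaken) E.reify =
      .app (.lam (t₀.inst E.reify.weaken)) t₁ := by
    rw [← Tm.exchange_subst_inst]
    exact congrArg _ (Tm.weaken_inst t₁ E.reify)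
  rwa [h'] at h

/-- The two steps by which `stailLeft` applied to a value captures its context. -/
theorem Red.stailLeft_value {n : ℕ} (E : PCtx n) (t₀ : Tm (n + 2)) (b : Tm (n + 1)) :
    Relation.TransGen Red (.reset (E.plug (stailLeft t₀ (.lam b))))
      (.reset ((t₀.subst (Tm.liftSub (Fin.cases (.lam b) .var))).inst E.reify)) :=
  .tail (.single (Red.beta_reset_plug E (.shift t₀) b)) (Red.shift_reset_plug E _)

/-- The substitutions for `k` and for `x` commute because `x` is not free in `E.reify`. The result
is the term reached in `Red.stailLeft_value`: this is where the two sides meet. -/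
theorem Red.captured_value {n : ℕ} (E : PCtx n) (t₀ : Tm (n + 2)) (b : Tm (n + 1)) :
    Red (.reset (.app (.lam (t₀.inst E.reify.weaken)) (.lam b)))
      (.reset ((t₀.subst (Tm.liftSub (Fin.cases (.lam b) .var))).inst E.reify)) := by
  have h := Red.beta_reset_plug .hole (t₀.inst E.reify.weaken) b
  have h' : (t₀.inst E.reify.weaken).inst (.lam b) =
      (t₀.subst (Tm.liftSub (Fin.cases (.lam b) .var))).inst E.reify :=
    (Tm.inst_subst _ _ _).trans (congrArg _ (Tm.weaken_inst E.reify (.lam b)))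
  rw [h'] at h
  exact h

/-! ## A congruence containing the two terms -/

mutual

/-- The congruence generated by `stailLeft` and `stailRight`, closed under the filling of
delimited contexts related by `RelCtx`. -/
inductive Rel : {n : ℕ} → Tm n → Tm n → Prop
  | var {n : ℕ} (i : Fin n) : Rel (.var i) (.var i)
  | lam {n : ℕ} {s t : Tm (n + 1)} : Rel s t → Rel (.lam s) (.lam t)
  | app {n : ℕ} {s s' t t' : Tm n} : Rel s s' → Rel t t' → Rel (.app s t) (.app s' t')
  | shift {n : ℕ} {s t : Tm (n + 1)} : Rel s t → Rel (.shift s) (.shift t)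
  | reset {n : ℕ} {E E' : PCtx n} {s s' : Tm n} : RelCtx E E' → Rel s s' →
      Rel (.reset (E.plug s)) (.reset (E'.plug s'))
  | stail {n : ℕ} {t₀ t₀' : Tm (n + 2)} {t₁ t₁' : Tm n} : Rel t₀ t₀' → Rel t₁ t₁' →
      Rel (stailLeft t₀ t₁) (stailRight t₀' t₁')

/-- Related delimited contexts: a context may have been captured on the right by `stailRight`
while the left is still evaluating the argument of `stailLeft`. -/
inductive RelCtx : {n : ℕ} → PCtx n → PCtx n → Prop
  | hole {n : ℕ} : RelCtx (.hole : PCtx n) .hole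
  -- Frames are added next to the hole, following the descent of evaluation into a term. In
  -- `captured`, the whole of `E'` can thus be absorbed into the function of a single remaining
  -- frame.
  | vapp {n : ℕ} {E E' : PCtx n} {b b' : Tm (n + 1)} : RelCtx E E' → Rel b b' →
      RelCtx (E.comp (.vapp b .hole)) (E'.comp (.vapp b' .hole))
  | app {n : ℕ} {E E' : PCtx n} {t t' : Tm n} : RelCtx E E' → Rel t t' →
      RelCtx (E.comp (.app .hole t)) (E'.comp (.app .hole t'))
  | captured {n : ℕ} {E E' : PCtx n} {t t' : Tm (n + 2)} : RelCtx E E' → Rel t t' →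
      RelCtx (E.comp (.vapp (.shift t) .hole)) (.vapp (t'.inst E'.reify.weaken) .hole)

end

theorem Rel.refl {n : ℕ} (t : Tm n) : Rel t t := by
  induction t with
  | var i => exact .var i
  | lam t ih => exact .lam ih
  | app s t ih₁ ih₂ => exact .app ih₁ ih₂
  | shift t ih => exact .shift ih
  | reset t ih => exact .reset .hole ih

mutual

/-- Substitutivity for a class of pairs of substitutions stable under binders. -/
theorem Rel.subst_of_class {P : ∀ {n m : ℕ}, (Fin n → Tm m) → (Fin n → Tm m) → Prop}
    (hP : ∀ {n m : ℕ} {σ τ : Fin n → Tm m}, P σ τ → ∀ i, Rel (σ i) (τ i))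
    (hlift : ∀ {n m : ℕ} {σ τ : Fin n → Tm m}, P σ τ → P (Tm.liftSub σ) (Tm.liftSub τ))
    {n : ℕ} {s t : Tm n} {m : ℕ} {σ τ : Fin n → Tm m} (hσ : P σ τ) :
    Rel s t → Rel (s.subst σ) (t.subst τ)
  | .var i => hP hσ i
  | .lam h => .lam (Rel.subst_of_class hP hlift (hlift hσ) h)
  | .app h₁ h₂ => .app (Rel.subst_of_class hP hlift hσ h₁) (Rel.subst_of_class hP hlift hσ h₂)
  | .shift h => .shift (Rel.subst_of_class hP hlift (hlift hσ) h)
  | .reset hE h => by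
    simp only [Tm.subst_reset, PCtx.plug_subst]
    exact .reset (RelCtx.subst_of_class hP hlift hσ hE) (Rel.subst_of_class hP hlift hσ h)
  | .stail h₀ h₁ => by
    rw [stailLeft_subst, stailRight_subst]
    exact .stail (Rel.subst_of_class hP hlift (hlift (hlift hσ)) h₀)
      (Rel.subst_of_class hP hlift hσ h₁)

/-- Substitutivity of `RelCtx` for a class of pairs of substitutions stable under binders. -/
theorem RelCtx.subst_of_class {P : ∀ {n m : ℕ}, (Fin n → Tm m) → (Fin n → Tm m) → Prop}
    (hP : ∀ {n m : ℕ} {σ τ : Fin n → Tm m}, P σ τ → ∀ i, Rel (σ i) (τ i))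
    (hlift : ∀ {n m : ℕ} {σ τ : Fin n → Tm m}, P σ τ → P (Tm.liftSub σ) (Tm.liftSub τ))
    {n : ℕ} {E E' : PCtx n} {m : ℕ} {σ τ : Fin n → Tm m} (hσ : P σ τ) :
    RelCtx E E' → RelCtx (E.subst σ) (E'.subst τ)
  | .hole => .hole
  | .vapp hE h => by
    simp only [PCtx.subst_comp]
    exact .vapp (RelCtx.subst_of_class hP hlift hσ hE)
      (Rel.subst_of_class hP hlift (hlift hσ) h)
  | .app hE h => by
    simp only [PCtx.subst_comp]
    exact .app (RelCtx.subst_of_class hP hlift hσ hE) (Rel.subst_of_class hP hlift hσ h)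
  | .captured hE h => by
    simp only [PCtx.subst_comp, PCtx.subst, Tm.inst_subst, Tm.weaken_subst, PCtx.reify_subst]
    exact .captured (RelCtx.subst_of_class hP hlift hσ hE)
      (Rel.subst_of_class hP hlift (hlift (hlift hσ)) h)

end

/-- `Rel.subst_of_class` is used twice. Renamings, seen as substitutions, are stable under binders
without any property of `Rel`; the closure under weakening so obtained makes pointwise related
substitutions stable under binders as well. -/
theorem rel_var_comp {n m : ℕ} {σ τ : Fin n → Tm m}
    (h : ∃ ρ : Fin n → Fin m, σ = (fun i => .var (ρ i)) ∧ τ = fun i => .var (ρ i)) (i : Fin n) :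
    Rel (σ i) (τ i) := by
  obtain ⟨ρ, rfl, rfl⟩ := h
  exact .var _

theorem liftSub_var_comp_class {n m : ℕ} {σ τ : Fin n → Tm m}
    (h : ∃ ρ : Fin n → Fin m, σ = (fun i => .var (ρ i)) ∧ τ = fun i => .var (ρ i)) :
    ∃ ρ : Fin (n + 1) → Fin (m + 1),
      Tm.liftSub σ = (fun i => .var (ρ i)) ∧ Tm.liftSub τ = fun i => .var (ρ i) := by
  obtain ⟨ρ, rfl, rfl⟩ := h
  exact ⟨Tm.liftRen ρ, Tm.liftSub_var_comp ρ, Tm.liftSub_var_comp ρ⟩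

theorem Rel.rename {n m : ℕ} {s t : Tm n} (h : Rel s t) (ρ : Fin n → Fin m) :
    Rel (s.rename ρ) (t.rename ρ) := by
  simp only [Tm.rename_eq_subst]
  exact h.subst_of_class rel_var_comp liftSub_var_comp_class ⟨ρ, rfl, rfl⟩

theorem RelCtx.weaken {n : ℕ} {E E' : PCtx n} (h : RelCtx E E') :
    RelCtx E.weaken E'.weaken := by
  simp only [PCtx.weaken_eq_subst]
  exact h.subst_of_class rel_var_comp liftSub_var_comp_class ⟨Fin.succ, rfl, rfl⟩

theorem RelCtx.reify {n : ℕ} {E E' : PCtx n} (h : RelCtx E E') : Rel E.reify E'.reify :=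
  .lam (.reset h.weaken (.var 0))

theorem rel_liftSub {n m : ℕ} {σ τ : Fin n → Tm m} (h : ∀ i, Rel (σ i) (τ i)) :
    ∀ i, Rel (Tm.liftSub σ i) (Tm.liftSub τ i) :=
  Fin.cases (.var 0) fun i => (h i).rename Fin.succ

theorem Rel.subst {n m : ℕ} {s t : Tm n} (h : Rel s t) {σ τ : Fin n → Tm m}
    (hσ : ∀ i, Rel (σ i) (τ i)) : Rel (s.subst σ) (t.subst τ) :=
  h.subst_of_class (P := fun σ τ => ∀ i, Rel (σ i) (τ i)) (fun h => h) rel_liftSub hσ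

theorem rel_cases {n : ℕ} {v w : Tm n} (h : Rel v w) (i : Fin (n + 1)) :
    Rel (Fin.cases (motive := fun _ => Tm n) v Tm.var i)
      (Fin.cases (motive := fun _ => Tm n) w Tm.var i) := by
  cases i using Fin.cases with
  | zero => exact h
  | succ i => exact .var i

theorem Rel.inst {n : ℕ} {s t : Tm (n + 1)} {v w : Tm n} (h : Rel s t) (hv : Rel v w) :
    Rel (s.inst v) (t.inst w) :=
  h.subst (rel_cases hv)

theorem Rel.subst_liftSub_cases {n : ℕ} {s t : Tm (n + 2)} {v w : Tm n} (h : Rel s t)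
    (hv : Rel v w) : Rel (s.subst (Tm.liftSub (Fin.cases v .var)))
      (t.subst (Tm.liftSub (Fin.cases w .var))) :=
  h.subst (rel_liftSub (rel_cases hv))

theorem Rel.program {n : ℕ} {s t : Tm n} (h : Rel s t) : Rel (.reset s) (.reset t) :=
  .reset .hole h

theorem Rel.isValue_iff {n : ℕ} {s t : Tm n} (h : Rel s t) : s.IsValue ↔ t.IsValue := by
  cases h <;> simp [Tm.IsValue, stailLeft, stailRight]

theorem Rel.isProgram_iff {n : ℕ} {s t : Tm n} (h : Rel s t) : s.IsProgram ↔ t.IsProgram := by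
  cases h <;> simp [Tm.IsProgram, stailLeft, stailRight]

theorem Rel.lam_inv {n : ℕ} {s t : Tm (n + 1)} (h : Rel (.lam s) (.lam t)) : Rel s t := by
  cases h
  assumption

/-! ## Related programs reduce to related terms -/

/-- Both terms make at least one step, to related terms. -/
def Progress {n : ℕ} (p q : Tm n) : Prop :=
  ∃ p' q', Relation.TransGen Red p p' ∧ Relation.TransGen Red q q' ∧ Rel p' q'

mutual

/-- Closed related terms are values or make related delimited contexts progress. -/
theorem Rel.values_or_progress {n : ℕ} [IsEmpty (Fin n)] {s s' : Tm n} : Rel s s' →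
    (s.IsValue ∧ s'.IsValue) ∨
      ∀ E E' : PCtx n, RelCtx E E' → Progress (.reset (E.plug s)) (.reset (E'.plug s'))
  -- Closedness, expressed as emptiness of `Fin n` with `n` kept general, excludes variables.
  | .var i => isEmptyElim i
  | .lam _ => .inl ⟨⟨_, rfl⟩, ⟨_, rfl⟩⟩
  | .app (s := s) (s' := s') (t := t) (t' := t') h₁ h₂ => by
    refine .inr fun E E' hE => ?_
    rcases Rel.values_or_progress h₁ with ⟨⟨b, rfl⟩, ⟨b', rfl⟩⟩ | h
    · rcases Rel.values_or_progress h₂ with ⟨⟨c, rfl⟩, ⟨c', rfl⟩⟩ | h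
      · exact ⟨_, _, .single (Red.beta_reset_plug E b c), .single (Red.beta_reset_plug E' b' c'),
          Rel.reset hE (h₁.lam_inv.inst h₂)⟩
      -- The frame moves into the context. The contexts are quantified in the conclusion, so they
      -- may grow while the recursion descends in the derivation of `Rel`.
      · simpa only [PCtx.plug_comp, PCtx.plug] using h _ _ (RelCtx.vapp hE h₁.lam_inv)
    · simpa only [PCtx.plug_comp, PCtx.plug] using h _ _ (RelCtx.app hE h₂)
  | .shift h => .inr fun E E' hE =>
    ⟨_, _, .single (Red.shift_reset_plug E _), .single (Red.shift_reset_plug E' _),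
      (h.inst hE.reify).program⟩
  | .reset (E := G) (E' := G') (s := s) (s' := s') hG h => by
    refine .inr fun E E' hE => ?_
    -- The inner reset delimits its own context `G`, so it progresses independently of `E`.
    have key : Progress (.reset (G.plug s)) (.reset (G'.plug s')) := by
      rcases Rel.values_or_progress h with ⟨⟨b, rfl⟩, ⟨b', rfl⟩⟩ | h'
      · exact RelCtx.progress hG h
      · exact h' _ _ hG
    obtain ⟨p, q, hp, hq, hpq⟩ := key
    exact ⟨_, _, Red.transGen_reset_plug E hp, Red.transGen_reset_plug E' hq, Rel.reset hE hpq⟩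
  | .stail (t₀ := t₀) (t₀' := t₀') h₀ h₁ => by
    refine .inr fun E E' hE => ?_
    rcases Rel.values_or_progress h₁ with ⟨⟨c, rfl⟩, ⟨c', rfl⟩⟩ | h
    · exact ⟨_, _, Red.stailLeft_value E t₀ c,
        .tail (.single (Red.stailRight E' t₀' _)) (Red.captured_value E' t₀' c'),
        ((h₀.subst_liftSub_cases h₁).inst hE.reify).program⟩
    -- One capture on the right leaves both arguments running in contexts related by `captured`.
    · obtain ⟨p, q, hp, hq, hpq⟩ := h _ _ (RelCtx.captured hE h₀)
      exact ⟨p, q, by simpa only [PCtx.plug_comp, PCtx.plug, stailLeft] using hp,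
        .head (Red.stailRight E' t₀' _) hq, hpq⟩

/-- Related delimited contexts filled with related values progress. -/
theorem RelCtx.progress {n : ℕ} [IsEmpty (Fin n)] {E E' : PCtx n} {b b' : Tm (n + 1)} :
    RelCtx E E' → Rel (.lam b) (.lam b') →
      Progress (.reset (E.plug (.lam b))) (.reset (E'.plug (.lam b')))
  | .hole, h =>
    ⟨_, _, .single (Red.reset .hole b), .single (Red.reset .hole b'), h⟩
  | .vapp (E := E) (E' := E') (b := c) (b' := c') hE hc, h => by
    simp only [PCtx.plug_comp, PCtx.plug]
    exact ⟨_, _, .single (Red.beta_reset_plug E c b), .single (Red.beta_reset_plug E' c' b'),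
      Rel.reset hE (hc.inst h)⟩
  | .app (E := E) (E' := E') hE ht, h => by
    simp only [PCtx.plug_comp, PCtx.plug]
    rcases Rel.values_or_progress ht with ⟨⟨c, rfl⟩, ⟨c', rfl⟩⟩ | h'
    · exact ⟨_, _, .single (Red.beta_reset_plug E b c), .single (Red.beta_reset_plug E' b' c'),
        Rel.reset hE (h.lam_inv.inst ht)⟩
    -- The function is now evaluated: the frame `□ t` turns into `v □`, and the argument runs there.
    · simpa only [PCtx.plug_comp, PCtx.plug] using h' _ _ (RelCtx.vapp hE h.lam_inv)
  | .captured (E := E) (E' := E') (t := t) (t' := t') hE ht, h => by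
    simp only [PCtx.plug_comp, PCtx.plug]
    exact ⟨_, _, Red.stailLeft_value E t b, .single (Red.captured_value E' t' b'),
      ((ht.subst_liftSub_cases h).inst hE.reify).program⟩

end

theorem Rel.progress {p q : Tm 0} (h : Rel p q) (hp : p.IsProgram) : Progress p q := by
  obtain ⟨p, rfl⟩ := hp
  obtain ⟨q, rfl⟩ := h.isProgram_iff.1 ⟨p, rfl⟩
  rcases h.values_or_progress with ⟨⟨_, h⟩, _⟩ | h'
  · simp at h
  · cases h with
    | reset hE h =>
      rcases h.values_or_progress with ⟨⟨b, rfl⟩, ⟨b', rfl⟩⟩ | h'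
      · exact hE.progress h
      · exact h' _ _ hE

/-! ## The bisimulation for programs -/

/-- Environments of related values. -/
def RelEnv (Γ : Env) : Prop := ∀ s t, (s, t) ∈ Γ → s.IsValue ∧ t.IsValue ∧ Rel s t

/-- Both terms reduce to related terms. -/
def RedsRel (s t : Tm 0) : Prop := ∃ s' t', Reds s s' ∧ Reds t t' ∧ Rel s' t'

/-- Since `Rel` is a congruence stable under renaming, it already contains the closure of every
environment it validates. -/
theorem TmClosure.rel {Γ : Env} (hΓ : RelEnv Γ) {n : ℕ} {s t : Tm n} (h : TmClosure Γ s t) :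
    Rel s t := by
  induction h with
  | base h hs ht => subst hs ht; exact (hΓ _ _ h).2.2.rename _
  | var i => exact .var i
  | lam _ ih => exact .lam ih
  | app _ _ ih₁ ih₂ => exact .app ih₁ ih₂
  | shift _ ih => exact .shift ih
  | reset _ ih => exact ih.program

theorem PCtxClosure.rel_plug {Γ : Env} (hΓ : RelEnv Γ) {E E' : PCtx 0}
    (h : PCtxClosure Γ E E') {s t : Tm 0} (hs : Rel s t) : Rel (E.plug s) (E'.plug t) := by
  induction h with
  | hole => exact hs
  | vapp _ hv ih => exact .app (hv.rel hΓ) ih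
  | app _ ht ih => exact .app ih (ht.rel hΓ)

theorem RelEnv.insert {Γ : Env} (hΓ : RelEnv Γ) {v w : Tm 0} (hv : v.IsValue) (hw : w.IsValue)
    (h : Rel v w) : RelEnv ({(v, w)} ∪ Γ) := by
  rintro s t (hst | hst)
  · obtain ⟨rfl, rfl⟩ := Prod.mk.inj hst
    exact ⟨hv, hw, h⟩
  · exact hΓ s t hst

theorem Reds.eq_or_of_red {n : ℕ} {s s' t : Tm n} (h : Reds s t) (hs : Red s s') :
    s = t ∨ Reds s' t := by
  rcases h.cases_head with rfl | ⟨u, hu, h⟩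
  · exact .inl rfl
  · exact .inr (hs.deterministic hu ▸ h)

theorem transGen_reds_of_red {n : ℕ} {s s' t : Tm n} (h : Relation.TransGen Red s t)
    (hs : Red s s') : Reds s' t := by
  obtain ⟨u, hu, h⟩ := Relation.TransGen.head'_iff.1 h
  exact hs.deterministic hu ▸ h

theorem Reds.eq_of_isValue {n : ℕ} {s t : Tm n} (h : Reds s t) (hs : s.IsValue) : t = s := by
  obtain ⟨b, rfl⟩ := hs
  rcases h.cases_head with h | ⟨u, hu, _⟩
  · exact h.symm
  · exact absurd hu (not_red_lam b u)

/-- By determinism the given step is the first one of the path from `p` to its related reduct. If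
that path is empty, `Rel.progress` supplies one with at least one step. -/
theorem RedsRel.red_left {p p' q : Tm 0} (h : RedsRel p q) (hp : p.IsProgram) (hr : Red p p') :
    RedsRel p' q := by
  obtain ⟨p₀, q₀, hp₀, hq₀, h₀⟩ := h
  rcases hp₀.eq_or_of_red hr with rfl | hp₀
  · obtain ⟨p₁, q₁, hp₁, hq₁, h₁⟩ := h₀.progress hp
    exact ⟨p₁, q₁, transGen_reds_of_red hp₁ hr, hq₀.trans hq₁.to_reflTransGen, h₁⟩
  · exact ⟨p₀, q₀, hp₀, hq₀, h₀⟩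

theorem RedsRel.red_right {p q q' : Tm 0} (h : RedsRel p q) (hq : q.IsProgram) (hr : Red q q') :
    RedsRel p q' := by
  obtain ⟨p₀, q₀, hp₀, hq₀, h₀⟩ := h
  rcases hq₀.eq_or_of_red hr with rfl | hq₀
  · obtain ⟨p₁, q₁, hp₁, hq₁, h₁⟩ := h₀.progress (h₀.isProgram_iff.2 hq)
    exact ⟨p₁, q₁, hp₀.trans hp₁.to_reflTransGen, transGen_reds_of_red hq₁ hr, h₁⟩
  · exact ⟨p₀, q₀, hp₀, hq₀, h₀⟩

theorem RedsRel.value_left {v q : Tm 0} (h : RedsRel v q) (hv : v.IsValue) :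
    ∃ w, w.IsValue ∧ Reds q w ∧ Rel v w := by
  obtain ⟨v', w, hv', hw, h⟩ := h
  obtain rfl := hv'.eq_of_isValue hv
  exact ⟨w, h.isValue_iff.1 hv, hw, h⟩

theorem RedsRel.value_right {p w : Tm 0} (h : RedsRel p w) (hw : w.IsValue) :
    ∃ v, v.IsValue ∧ Reds p v ∧ Rel v w := by
  obtain ⟨v, w', hv, hw', h⟩ := h
  obtain rfl := hw'.eq_of_isValue hw
  exact ⟨v, h.isValue_iff.2 hw, hv, h⟩

theorem isProgBisim_redsRel :
    IsProgBisim ⟨RelEnv, fun Γ s t => RelEnv Γ ∧ RedsRel s t⟩ where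
  wf_env Γ h s t hst := ⟨(h s t hst).1, (h s t hst).2.1⟩
  wf_tm Γ _ _ h s t hst := ⟨(h.1 s t hst).1, (h.1 s t hst).2.1⟩
  term := by
    rintro Γ s t ⟨hΓ, s', t', hs, ht, h⟩ - E E' hE
    exact ⟨hΓ, _, _, hs.reset_plug E, ht.reset_plug E', (hE.rel_plug hΓ h).program⟩
  -- Steps between programs are answered by zero steps; only reaching a value forces the other side
  -- to move.
  red_left := fun Γ p q h hp hq p' _ hr => ⟨q, hq, .refl, h.1, h.2.red_left hp hr⟩
  red_right := fun Γ p q h hp hq q' _ hr => ⟨p, hp, .refl, h.1, h.2.red_right hq hr⟩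
  val_left := fun Γ p q h hp _ v hv hr => by
    obtain ⟨w, hw, hqw, hvw⟩ := (h.2.red_left hp hr).value_left hv
    exact ⟨w, hw, hqw, h.1.insert hv hw hvw⟩
  val_right := fun Γ p q h _ hq w hw hr => by
    obtain ⟨v, hv, hpv, hvw⟩ := (h.2.red_right hq hr).value_right hw
    exact ⟨v, hv, hpv, h.1.insert hv hw hvw⟩
  env_val := fun Γ hΓ s t v w hst _ _ hvw =>
    ⟨hΓ, _, _, .refl, .refl, (hΓ _ _ hst).2.2.lam_inv.inst (hvw.rel hΓ)⟩

theorem Rel.progBisimilar {s t : Tm 0} (h : Rel s t) : ProgBisimilar s t :=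
  ⟨_, isProgBisim_redsRel, fun _ _ h => h.elim, s, t, .refl, .refl, h⟩

theorem Rel.lams : {n : ℕ} → {s t : Tm n} → Rel s t → Rel s.lams t.lams
  | 0, _, _, h => h
  | _ + 1, s, t, h => Rel.lams (s := s.lam) (t := t.lam) (.lam h)

/-! ## Divergence separates the two terms in the relaxed semantics -/

/-- By determinism every reduct lies on the given infinite sequence, hence is reducible. -/
theorem Diverges.not_reds_stuck {n : ℕ} {s t : Tm n} (hs : Diverges s) (h : Reds s t) :
    ¬ IsStuck t := by
  obtain ⟨f, rfl, hf⟩ := hs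
  have key : ∃ i, t = f i := by
    induction h with
    | refl => exact ⟨0, rfl⟩
    | tail _ hr ih =>
      obtain ⟨i, rfl⟩ := ih
      exact ⟨i + 1, hr.deterministic (hf i)⟩
  obtain ⟨i, rfl⟩ := key
  exact fun h => h.2 _ (hf i)

theorem Diverges.stailLeft {n : ℕ} (t₀ : Tm (n + 2)) {t₁ : Tm n} (h : Diverges t₁) :
    Diverges (stailLeft t₀ t₁) := by
  obtain ⟨f, rfl, hf⟩ := h
  exact ⟨fun i => ShiftReset.stailLeft t₀ (f i), rfl,
    fun i => (hf i).plug (.vapp (.shift t₀) .hole)⟩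

theorem not_bisimilar_of_diverges (t₀ : Tm 2) {t₁ : Tm 0} (h : Diverges t₁) :
    ¬ Bisimilar (stailLeft t₀ t₁) (stailRight t₀ t₁) := by
  rintro ⟨R, hR, hst⟩
  -- `stailRight` is a bare `shift`, hence stuck, so the left term would have to reach a stuck term.
  obtain ⟨s, hs, hs', _⟩ := hR.stuck_right _ _ _ hst (isStuck_shift _)
  exact (h.stailLeft t₀).not_reds_stuck hs hs'

/-- The term `(λx. x x) (λx. x x)`. -/
def omega : Tm 0 :=
  .app (.lam (.app (.var 0) (.var 0))) (.lam (.app (.var 0) (.var 0)))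

theorem diverges_omega : Diverges omega :=
  ⟨fun _ => omega, rfl, fun _ => Red.beta .hole (.app (.var 0) (.var 0)) (.app (.var 0) (.var 0))⟩

end ShiftReset

theorem lemmal :
    (∀ (n : ℕ) (t₀ : ShiftReset.Tm (n + 2)) (t₁ : ShiftReset.Tm n),
      ShiftReset.OpenProgBisimilar (ShiftReset.stailLeft t₀ t₁) (ShiftReset.stailRight t₀ t₁)) ∧
    (¬ ∀ (t₀ : ShiftReset.Tm 2) (t₁ : ShiftReset.Tm 0),
      ShiftReset.Bisimilar (ShiftReset.stailLeft t₀ t₁) (ShiftReset.stailRight t₀ t₁)) ∧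
    (∀ (t₀ : ShiftReset.Tm 2) (t₁ : ShiftReset.Tm 0), ShiftReset.Diverges t₁ →
      ¬ ShiftReset.Bisimilar (ShiftReset.stailLeft t₀ t₁) (ShiftReset.stailRight t₀ t₁)) :=
  ⟨fun _ t₀ t₁ => (ShiftReset.Rel.stail (.refl t₀) (.refl t₁)).lams.progBisimilar,
    fun h => ShiftReset.not_bisimilar_of_diverges (.var 0) ShiftReset.diverges_omega (h _ _),
    fun t₀ _ h => ShiftReset.not_bisimilar_of_diverges t₀ h⟩
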